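/- Let $\mathbb{K}$ be a quadratically closed field of arbitrary characteristic, i.e. a field over which every polynomial of degree $2$ has a root. Let $\mathrm{A}_4(\mathbb{K})$ be the space of alternating $4\times 4$ matrices over $\mathbb{K}$ (skew-symmetric matrices with zero diagonal), and call two linear subspaces $V,W$ of $\mathrm{A}_4(\mathbb{K})$ congruent when $W=\{PMP^T : M\in V\}$ for some $P\in \mathrm{GL}_4(\mathbb{K})$. A generic matrix of a subspace with basis $(A_1,\dots,A_s)$ is the matrix $\mathbf{x}_1A_1+\cdots+\mathbf{x}_sA_s$, where $\mathbf{x}_1,\dots,\mathbf{x}_s$ are independent indeterminates. Then, up to congruence, there are exactly five $3$-dimensional linear subspaces of $\mathrm{A}_4(\mathbb{K})$: the subspaces with the following generic matrices (in the indeterminates $\mathbf{a},\mathbf{b},\mathbf{c}$) are pairwise non-congruent $3$-dimensional subspaces of $\mathrm{A}_4(\mathbb{K})$, and every $3$-dimensional subspace of $\mathrm{A}_4(\mathbb{K})$ is congruent to one of them: $$\mathbf{A}_1=\begin{bmatrix} 0&\mathbf{a}&\mathbf{b}&\mathbf{c}\\ -\mathbf{a}&0&0&0\\ -\mathbf{b}&0&0&0\\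 -\mathbf{c}&0&0&0\end{bmatrix},\quad \mathbf{A}_2=\begin{bmatrix} 0&0&0&0\\ 0&0&\mathbf{a}&\mathbf{b}\\ 0&-\mathbf{a}&0&\mathbf{c}\\ 0&-\mathbf{b}&-\mathbf{c}&0\end{bmatrix},\quad \mathbf{A}_3=\begin{bmatrix} 0&\mathbf{a}&\mathbf{b}&\mathbf{c}\\ -\mathbf{a}&0&\mathbf{c}&0\\ -\mathbf{b}&-\mathbf{c}&0&0\\ -\mathbf{c}&0&0&0\end{bmatrix},$$ $$\mathbf{A}_4=\begin{bmatrix} 0&\mathbf{a}&\mathbf{b}&0\\ -\mathbf{a}&0&0&\mathbf{c}\\ -\mathbf{b}&0&0&0\\ 0&-\mathbf{c}&0&0\end{bmatrix},\quad \mathbf{A}_5=\begin{bmatrix} 0&\mathbf{a}&\mathbf{b}&0\\ -\mathbf{a}&0&0&\mathbf{c}\\ -\mathbf{b}&0&0&\mathbf{a}\\ 0&-\mathbf{c}&-\mathbf{a}&0\end{bmatrix}.$$ -/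

import Mathlib

open Matrix

namespace AltSpaces

/-- A field is quadratically closed when it has no quadratic extension, i.e. every (monic)
polynomial of degree two has a root. Outside characteristic two this says that every
element is a square. -/
def QuadraticallyClosed (K : Type*) [Field K] : Prop :=
  ∀ b c : K, ∃ x : K, x ^ 2 + b * x + c = 0

/-- The space of alternating `n × n` matrices: skew-symmetric with zero diagonal. -/
def altMatrices (K : Type*) [Field K] (n : ℕ) : Submodule K (Matrix (Fin n) (Fin n) K) where
  carrier := {M | Mᵀ = -M ∧ ∀ i, M i i = 0}
  add_mem' := by
    rintro M N ⟨hM, hM'⟩ ⟨hN, hN'⟩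
    refine ⟨?_, fun i => ?_⟩
    · rw [transpose_add, hM, hN, neg_add]
    · rw [Matrix.add_apply, hM' i, hN' i, add_zero]
  zero_mem' := by simp
  smul_mem' := by
    rintro c M ⟨hM, hM'⟩
    refine ⟨?_, fun i => ?_⟩
    · rw [transpose_smul, hM, smul_neg]
    · rw [Matrix.smul_apply, hM' i, smul_zero]

/-- The `d`-dimensional linear subspaces of the space of alternating `n × n` matrices. -/
def AltSubspace (K : Type*) [Field K] (n d : ℕ) : Type _ :=
  {S : Submodule K (Matrix (Fin n) (Fin n) K) //
    S ≤ altMatrices K n ∧ Module.finrank K S = d}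

/-- Two linear subspaces `S`, `T` of square matrices are congruent when `T = P S Pᵀ` for
some invertible matrix `P`. -/
def Congruent {K : Type*} [Field K] {n : ℕ} (S T : Submodule K (Matrix (Fin n) (Fin n) K)) :
    Prop :=
  ∃ P : GL (Fin n) K,
    (T : Set (Matrix (Fin n) (Fin n) K)) =
      (fun M => (P : Matrix (Fin n) (Fin n) K) * M * (P : Matrix (Fin n) (Fin n) K)ᵀ) '' S

theorem Congruent.refl {K : Type*} [Field K] {n : ℕ}
    (S : Submodule K (Matrix (Fin n) (Fin n) K)) : Congruent S S :=
  ⟨1, by simp⟩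

theorem Congruent.symm {K : Type*} [Field K] {n : ℕ}
    {S T : Submodule K (Matrix (Fin n) (Fin n) K)} (h : Congruent S T) : Congruent T S := by
  obtain ⟨P, hP⟩ := h
  refine ⟨P⁻¹, ?_⟩
  have key : ∀ M : Matrix (Fin n) (Fin n) K,
      ((P⁻¹ : GL (Fin n) K) : Matrix (Fin n) (Fin n) K) *
        ((P : Matrix (Fin n) (Fin n) K) * M * (P : Matrix (Fin n) (Fin n) K)ᵀ) *
        ((P⁻¹ : GL (Fin n) K) : Matrix (Fin n) (Fin n) K)ᵀ = M := by
    intro M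
    have h1 : ((P⁻¹ : GL (Fin n) K) : Matrix (Fin n) (Fin n) K) *
        (P : Matrix (Fin n) (Fin n) K) = 1 := by
      rw [← Units.val_mul, inv_mul_cancel, Units.val_one]
    have h2 : (P : Matrix (Fin n) (Fin n) K)ᵀ *
        ((P⁻¹ : GL (Fin n) K) : Matrix (Fin n) (Fin n) K)ᵀ = 1 := by
      rw [← transpose_mul, h1, transpose_one]
    rw [← Matrix.mul_assoc, ← Matrix.mul_assoc, h1, Matrix.one_mul, Matrix.mul_assoc, h2,
      Matrix.mul_one]
  rw [hP, Set.image_image]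
  simp only [key, Set.image_id']

theorem Congruent.trans {K : Type*} [Field K] {n : ℕ}
    {S T U : Submodule K (Matrix (Fin n) (Fin n) K)} (h : Congruent S T)
    (h' : Congruent T U) : Congruent S U := by
  obtain ⟨P, hP⟩ := h
  obtain ⟨Q, hQ⟩ := h'
  refine ⟨Q * P, ?_⟩
  rw [hQ, hP, Set.image_image]
  simp only [Units.val_mul, transpose_mul, Matrix.mul_assoc]

/-- Congruence, as an equivalence relation on the `d`-dimensional subspaces of alternating
matrices; its classes are the congruence classes. -/
def congruenceSetoid (K : Type*) [Field K] (n d : ℕ) : Setoid (AltSubspace K n d) where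
  r S T := Congruent S.1 T.1
  iseqv := ⟨fun S => Congruent.refl S.1, fun h => h.symm, fun h h' => h.trans h'⟩

/-- `A` is a generic matrix of `S`: `A = x₁ A₁ + ⋯ + xₛ Aₛ` for some basis `(A₁, …, Aₛ)` of
`S`, the `xₖ` being independent indeterminates. -/
def IsGenericMatrix {K : Type*} [Field K] {n s : ℕ}
    (S : Submodule K (Matrix (Fin n) (Fin n) K))
    (A : Matrix (Fin n) (Fin n) (MvPolynomial (Fin s) K)) : Prop :=
  ∃ B : Module.Basis (Fin s) K S,
    A = ∑ k, (MvPolynomial.X k : MvPolynomial (Fin s) K) •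
      (B k : Matrix (Fin n) (Fin n) K).map MvPolynomial.C

/-- The five generic matrices `𝐀₁, …, 𝐀₅`, in the indeterminates `a`, `b`, `c`. -/
noncomputable def genericMatrix (K : Type*) [Field K] :
    Fin 5 → Matrix (Fin 4) (Fin 4) (MvPolynomial (Fin 3) K) :=
  let a : MvPolynomial (Fin 3) K := MvPolynomial.X 0
  let b : MvPolynomial (Fin 3) K := MvPolynomial.X 1
  let c : MvPolynomial (Fin 3) K := MvPolynomial.X 2
  ![!![ 0,  a,  b,  c;
       -a,  0,  0,  0;
       -b,  0,  0,  0;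
       -c,  0,  0,  0],
    !![ 0,  0,  0,  0;
        0,  0,  a,  b;
        0, -a,  0,  c;
        0, -b, -c,  0],
    !![ 0,  a,  b,  c;
       -a,  0,  c,  0;
       -b, -c,  0,  0;
       -c,  0,  0,  0],
    !![ 0,  a,  b,  0;
       -a,  0,  0,  c;
       -b,  0,  0,  0;
        0, -c,  0,  0],
    !![ 0,  a,  b,  0;
       -a,  0,  0,  c;
       -b,  0,  0,  a;
        0, -c, -a,  0]]

end AltSpaces

/-! Identify an alternating 4 × 4 matrix with a bivector on K⁴, writing e₀, …, e₃ for the standard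
basis. Its Pfaffian af − be + cd is a hyperbolic quadratic form on K⁶ whose nonzero zeros are the
decomposable bivectors u ∧ v. Congruence acts by u ∧ v ↦ Pu ∧ Pv and multiplies the Pfaffian by det
P, so the restriction of the Pfaffian to a subspace is an invariant up to scaling.

On the five standard spaces this restriction is 0, 0, c², −bc and a² − bc. The zero set of the form
separates these types in every characteristic: it is the whole space, a proper subspace, invariant
under a nonzero translation, or none of these (`eq_of_congruent_standardSpace`). The two totally
isotropic spaces are e₀ ∧ K⁴ and the bivectors of a hyperplane; only the second has a common kernel
vector.

Conversely, over a quadratically closed field every plane of bivectors contains an isotropic line,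
so some generator may be moved to e₀ ∧ e₁ (`exists_congr_eq_of_isotropic`). If another generator
pairs nontrivially with it under the polar form, a hyperbolic plane splits off, and the rank of a 2
× 2 block decides between 𝐀₄ and 𝐀₅ (`isClassified_of_hyperbolic`). Otherwise a second isotropic
generator is found orthogonal to the first, the pair becomes e₀ ∧ e₁, e₀ ∧ e₂, and
`isClassified_of_isotropic_pair` inspects the third generator. -/

namespace AltSpaces

open Submodule

/-! ### Coordinates and the Pfaffian on alternating 4 × 4 matrices. -/

section Coordinates

variable {K : Type*} [Field K]

/-- The alternating `4 × 4` matrix with the given entries above the diagonal. -/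
def altOf (a b c d e f : K) : Matrix (Fin 4) (Fin 4) K :=
  !![0, a, b, c; -a, 0, d, e; -b, -d, 0, f; -c, -e, -f, 0]

theorem altOf_add (a b c d e f a' b' c' d' e' f' : K) :
    altOf a b c d e f + altOf a' b' c' d' e' f' =
      altOf (a + a') (b + b') (c + c') (d + d') (e + e') (f + f') := by
  ext i j
  fin_cases i <;> fin_cases j <;> simp [altOf] <;> ring

theorem smul_altOf (x a b c d e f : K) :
    x • altOf a b c d e f = altOf (x * a) (x * b) (x * c) (x * d) (x * e) (x * f) := by
  ext i j
  fin_cases i <;> fin_cases j <;> simp [altOf]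

theorem altOf_eq_zero : altOf (0 : K) 0 0 0 0 0 = 0 := by
  ext i j
  fin_cases i <;> fin_cases j <;> simp [altOf]

theorem altOf_inj {a b c d e f a' b' c' d' e' f' : K} :
    altOf a b c d e f = altOf a' b' c' d' e' f' ↔
      a = a' ∧ b = b' ∧ c = c' ∧ d = d' ∧ e = e' ∧ f = f' := by
  refine ⟨fun h => ?_, by rintro ⟨rfl, rfl, rfl, rfl, rfl, rfl⟩; rfl⟩
  exact ⟨congrFun (congrFun h 0) 1, congrFun (congrFun h 0) 2, congrFun (congrFun h 0) 3,
    congrFun (congrFun h 1) 2, congrFun (congrFun h 1) 3, congrFun (congrFun h 2) 3⟩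

theorem altOf_eq_zero_iff {a b c d e f : K} :
    altOf a b c d e f = 0 ↔ a = 0 ∧ b = 0 ∧ c = 0 ∧ d = 0 ∧ e = 0 ∧ f = 0 := by
  rw [← altOf_eq_zero, altOf_inj]

theorem altOf_mem (a b c d e f : K) : altOf a b c d e f ∈ altMatrices K 4 := by
  refine ⟨?_, fun i => by fin_cases i <;> rfl⟩
  ext i j
  fin_cases i <;> fin_cases j <;> simp [altOf]

theorem exists_eq_altOf {M : Matrix (Fin 4) (Fin 4) K} (hM : M ∈ altMatrices K 4) :
    ∃ a b c d e f, M = altOf a b c d e f := by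
  obtain ⟨h, h0⟩ := hM
  have h' : ∀ i j, M j i = -M i j := fun i j => congrFun (congrFun h i) j
  refine ⟨M 0 1, M 0 2, M 0 3, M 1 2, M 1 3, M 2 3, ?_⟩
  ext i j
  fin_cases i <;> fin_cases j <;> simp [altOf, h0] <;> exact h' _ _

/-- The determinant of an alternating matrix is the square of its Pfaffian. -/
theorem det_altOf (a b c d e f : K) :
    (altOf a b c d e f).det = (a * f - b * e + c * d) ^ 2 := by
  simp [altOf, Matrix.det_succ_row_zero, Fin.sum_univ_succ, Fin.succAbove]
  ring

/-- The action of an explicit matrix on an alternating matrix by congruence. -/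
theorem congr_altOf (P : Matrix (Fin 4) (Fin 4) K) (a b c d e f : K) :
    P * altOf a b c d e f * Pᵀ =
      let m : Fin 4 → Fin 4 → K := fun i j =>
        a * (P i 0 * P j 1 - P i 1 * P j 0) + b * (P i 0 * P j 2 - P i 2 * P j 0) +
        c * (P i 0 * P j 3 - P i 3 * P j 0) + d * (P i 1 * P j 2 - P i 2 * P j 1) +
        e * (P i 1 * P j 3 - P i 3 * P j 1) + f * (P i 2 * P j 3 - P i 3 * P j 2)
      altOf (m 0 1) (m 0 2) (m 0 3) (m 1 2) (m 1 3) (m 2 3) := by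
  have key : ∀ i j, (P * altOf a b c d e f * Pᵀ) i j =
      a * (P i 0 * P j 1 - P i 1 * P j 0) + b * (P i 0 * P j 2 - P i 2 * P j 0) +
      c * (P i 0 * P j 3 - P i 3 * P j 0) + d * (P i 1 * P j 2 - P i 2 * P j 1) +
      e * (P i 1 * P j 3 - P i 3 * P j 1) + f * (P i 2 * P j 3 - P i 3 * P j 2) := by
    intro i j
    simp [Matrix.mul_apply, Fin.sum_univ_four, altOf]
    ring
  ext i j
  rw [key]
  fin_cases i <;> fin_cases j <;> simp [altOf] <;> ring

end Coordinates

/-! ### Congruence and change of generators for spans of three elements. -/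

section Spans

variable {K : Type*} [Field K] {n : ℕ}

theorem congruent_span_triple {A B C A' B' C' : Matrix (Fin n) (Fin n) K}
    (P : Matrix (Fin n) (Fin n) K) (hP : P.det ≠ 0)
    (hA : P * A * Pᵀ = A') (hB : P * B * Pᵀ = B') (hC : P * C * Pᵀ = C') :
    Congruent (span K {A, B, C}) (span K {A', B', C'}) := by
  refine ⟨Matrix.GeneralLinearGroup.mkOfDetNeZero P hP, ?_⟩
  have hP' : (Matrix.GeneralLinearGroup.mkOfDetNeZero P hP : Matrix (Fin n) (Fin n) K) = P := rfl
  rw [hP']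
  subst hA hB hC
  ext M
  simp only [SetLike.mem_coe, Set.mem_image, mem_span_triple]
  constructor
  · rintro ⟨x, y, z, rfl⟩
    exact ⟨_, ⟨x, y, z, rfl⟩, by simp [Matrix.mul_add, Matrix.add_mul]⟩
  · rintro ⟨_, ⟨x, y, z, rfl⟩, rfl⟩
    exact ⟨x, y, z, by simp [Matrix.mul_add, Matrix.add_mul]⟩

theorem Congruent.finrank_eq {S T : Submodule K (Matrix (Fin n) (Fin n) K)}
    (h : Congruent S T) : Module.finrank K S = Module.finrank K T := by
  have key : ∀ {S T : Submodule K (Matrix (Fin n) (Fin n) K)}, Congruent S T →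
      Module.finrank K T ≤ Module.finrank K S := by
    rintro S T ⟨P, hP⟩
    let f : Matrix (Fin n) (Fin n) K →ₗ[K] Matrix (Fin n) (Fin n) K :=
      LinearMap.mulRight K (P : Matrix (Fin n) (Fin n) K)ᵀ ∘ₗ
        LinearMap.mulLeft K (P : Matrix (Fin n) (Fin n) K)
    have : T = S.map f := SetLike.coe_injective (by rw [hP]; rfl)
    rw [this]
    exact finrank_map_le f S
  exact le_antisymm (key h.symm) (key h)

variable {E : Type*} [AddCommGroup E] [Module K E]

theorem span_triple_swap_left (A B C : E) :
    span K {A, B, C} = span K {B, A, C} := by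
  rw [Set.insert_comm]

theorem span_triple_swap_right (A B C : E) :
    span K {A, B, C} = span K {A, C, B} := by
  rw [Set.pair_comm]

theorem span_triple_change_left {A A' B C : E} {x : K} (hx : x ≠ 0) (y z : K)
    (h : A' = x • A + y • B + z • C) : span K {A, B, C} = span K {A', B, C} := by
  subst h
  ext M
  simp only [mem_span_triple]
  constructor
  · rintro ⟨r, s, t, rfl⟩
    refine ⟨r / x, s - r / x * y, t - r / x * z, ?_⟩
    match_scalars <;> field_simp <;> ring
  · rintro ⟨r, s, t, rfl⟩
    exact ⟨r * x, s + r * y, t + r * z, by module⟩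

theorem span_triple_change_mid {A B B' C : E} (x : K) {y : K} (hy : y ≠ 0) (z : K)
    (h : B' = x • A + y • B + z • C) : span K {A, B, C} = span K {A, B', C} := by
  rw [span_triple_swap_left, span_triple_change_left hy x z (h.trans (by abel)),
    span_triple_swap_left]

theorem span_triple_change_right {A B C C' : E} (x y : K) {z : K} (hz : z ≠ 0)
    (h : C' = x • A + y • B + z • C) : span K {A, B, C} = span K {A, B, C'} := by
  rw [span_triple_swap_right, span_triple_change_mid x hz y (h.trans (by abel)),
    span_triple_swap_right]

/-- Two generators span at most a plane. This is how dimension 3 enters the classification: it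
excludes degenerate generators. -/
theorem ne_zero_of_finrank_span_triple {A B C : E}
    (h : Module.finrank K (span K {A, B, C}) = 3) : A ≠ 0 := by
  rintro rfl
  rw [span_insert_zero] at h
  classical
  have := finrank_span_finset_le_card (R := K) ({B, C} : Finset E)
  have h2 := Finset.card_le_two (a := B) (b := C)
  rw [Set.finrank, Finset.coe_pair] at this
  omega

end Spans

/-! ### The five standard spaces and their generic matrices. -/

section Standard

variable (K : Type*) [Field K]

/-- The bases of the five standard spaces, in the order of the indeterminates `a`, `b`, `c`. -/
def standardBasis : Fin 5 → Fin 3 → Matrix (Fin 4) (Fin 4) K :=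
  ![![altOf 1 0 0 0 0 0, altOf 0 1 0 0 0 0, altOf 0 0 1 0 0 0],
    ![altOf 0 0 0 1 0 0, altOf 0 0 0 0 1 0, altOf 0 0 0 0 0 1],
    ![altOf 1 0 0 0 0 0, altOf 0 1 0 0 0 0, altOf 0 0 1 1 0 0],
    ![altOf 1 0 0 0 0 0, altOf 0 1 0 0 0 0, altOf 0 0 0 0 1 0],
    ![altOf 1 0 0 0 0 1, altOf 0 1 0 0 0 0, altOf 0 0 0 0 1 0]]

/-- The five standard spaces. -/
def standardSpace (i : Fin 5) : Submodule K (Matrix (Fin 4) (Fin 4) K) :=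
  span K {standardBasis K i 0, standardBasis K i 1, standardBasis K i 2}

theorem range_standardBasis (i : Fin 5) :
    Set.range (standardBasis K i) =
      {standardBasis K i 0, standardBasis K i 1, standardBasis K i 2} := by
  ext M
  simp [Fin.exists_fin_succ, eq_comm]

theorem linearIndependent_standardBasis (i : Fin 5) :
    LinearIndependent K (standardBasis K i) := by
  rw [Fintype.linearIndependent_iff]
  intro g hg
  rw [Fin.sum_univ_three] at hg
  rw [Fin.forall_fin_succ, Fin.forall_fin_two]
  fin_cases i <;>
    simp [standardBasis, smul_altOf, altOf_add, altOf_eq_zero_iff] at hg ⊢ <;> tauto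

theorem standardBasis_mem (i : Fin 5) (k : Fin 3) :
    standardBasis K i k ∈ altMatrices K 4 := by
  fin_cases i <;> fin_cases k <;> exact altOf_mem _ _ _ _ _ _

theorem standardSpace_le (i : Fin 5) : standardSpace K i ≤ altMatrices K 4 := by
  rw [standardSpace, ← range_standardBasis, span_le, Set.range_subset_iff]
  exact standardBasis_mem K i

theorem finrank_standardSpace (i : Fin 5) : Module.finrank K (standardSpace K i) = 3 := by
  rw [standardSpace, ← range_standardBasis,
    finrank_span_eq_card (linearIndependent_standardBasis K i), Fintype.card_fin]

theorem isGenericMatrix_standardSpace (i : Fin 5) :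
    IsGenericMatrix (standardSpace K i) (genericMatrix K i) := by
  rw [standardSpace, ← range_standardBasis]
  refine ⟨Module.Basis.span (linearIndependent_standardBasis K i), ?_⟩
  simp only [Module.Basis.span_apply, Fin.sum_univ_three]
  ext1 r s
  fin_cases i <;> fin_cases r <;> fin_cases s <;>
    simp [genericMatrix, standardBasis, altOf]

end Standard

/-! ### Congruence invariants separating the standard spaces. -/

section Invariants

variable {K : Type*} [Field K] {n : ℕ}

/-- All matrices of the space are singular. -/
def AllSingular (S : Submodule K (Matrix (Fin n) (Fin n) K)) : Prop :=
  ∀ M ∈ S, M.det = 0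

/-- The matrices of the space have a common nonzero kernel vector. -/
def HasCommonKernel (S : Submodule K (Matrix (Fin n) (Fin n) K)) : Prop :=
  ∃ x : Fin n → K, x ≠ 0 ∧ ∀ M ∈ S, M *ᵥ x = 0

/-- The singular matrices of the space are closed under addition. -/
def SingularAddClosed (S : Submodule K (Matrix (Fin n) (Fin n) K)) : Prop :=
  ∀ M ∈ S, ∀ N ∈ S, M.det = 0 → N.det = 0 → (M + N).det = 0

/-- Translation by some nonzero matrix of the space preserves its singular matrices. -/
def HasSingularTranslation (S : Submodule K (Matrix (Fin n) (Fin n) K)) : Prop :=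
  ∃ M ∈ S, M ≠ 0 ∧ ∀ N ∈ S, N.det = 0 → (M + N).det = 0

theorem det_congr_eq_zero_iff (P : GL (Fin n) K) (M : Matrix (Fin n) (Fin n) K) :
    ((P : Matrix (Fin n) (Fin n) K) * M * (P : Matrix (Fin n) (Fin n) K)ᵀ).det = 0 ↔
      M.det = 0 := by
  have hP : (P : Matrix (Fin n) (Fin n) K).det ≠ 0 := P.det.ne_zero
  simp [hP]

theorem congr_eq_zero_iff (P : GL (Fin n) K) (M : Matrix (Fin n) (Fin n) K) :
    (P : Matrix (Fin n) (Fin n) K) * M * (P : Matrix (Fin n) (Fin n) K)ᵀ = 0 ↔ M = 0 := by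
  have hP : IsUnit (P : Matrix (Fin n) (Fin n) K) := P.isUnit
  have hP' : IsUnit (P : Matrix (Fin n) (Fin n) K)ᵀ := by rwa [Matrix.isUnit_transpose]
  rw [hP'.mul_left_eq_zero, hP.mul_right_eq_zero]

variable {S T : Submodule K (Matrix (Fin n) (Fin n) K)}

theorem Congruent.mem_iff_exists (h : Congruent S T) :
    ∃ P : GL (Fin n) K, ∀ M, M ∈ T ↔ ∃ N ∈ S,
      (P : Matrix (Fin n) (Fin n) K) * N * (P : Matrix (Fin n) (Fin n) K)ᵀ = M := by
  obtain ⟨P, hP⟩ := h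
  refine ⟨P, fun M => ?_⟩
  rw [← SetLike.mem_coe, hP]
  rfl

theorem AllSingular.congr (h : Congruent S T) (hS : AllSingular S) : AllSingular T := by
  obtain ⟨P, hP⟩ := h.mem_iff_exists
  intro M hM
  obtain ⟨N, hN, rfl⟩ := (hP M).1 hM
  exact (det_congr_eq_zero_iff P N).2 (hS N hN)

theorem HasCommonKernel.congr (h : Congruent S T) (hT : HasCommonKernel T) :
    HasCommonKernel S := by
  obtain ⟨P, hP⟩ := h.mem_iff_exists
  obtain ⟨x, hx, hx'⟩ := hT
  have hu : IsUnit (P : Matrix (Fin n) (Fin n) K)ᵀ := by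
    rw [Matrix.isUnit_transpose]; exact P.isUnit
  refine ⟨(P : Matrix (Fin n) (Fin n) K)ᵀ *ᵥ x, fun h0 => hx ?_, fun M hM => ?_⟩
  · exact Matrix.mulVec_injective_of_isUnit hu (by rw [h0, Matrix.mulVec_zero])
  · have := hx' _ ((hP _).2 ⟨M, hM, rfl⟩)
    rw [Matrix.mul_assoc, ← Matrix.mulVec_mulVec, ← Matrix.mulVec_mulVec] at this
    exact Matrix.mulVec_injective_of_isUnit P.isUnit (by rw [this, Matrix.mulVec_zero])

theorem SingularAddClosed.congr (h : Congruent S T) (hS : SingularAddClosed S) :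
    SingularAddClosed T := by
  obtain ⟨P, hP⟩ := h.mem_iff_exists
  intro M hM N hN
  obtain ⟨M', hM', rfl⟩ := (hP M).1 hM
  obtain ⟨N', hN', rfl⟩ := (hP N).1 hN
  rw [← Matrix.add_mul, ← Matrix.mul_add]
  simp only [det_congr_eq_zero_iff]
  exact hS M' hM' N' hN'

theorem HasSingularTranslation.congr (h : Congruent S T) (hS : HasSingularTranslation S) :
    HasSingularTranslation T := by
  obtain ⟨P, hP⟩ := h.mem_iff_exists
  obtain ⟨M, hM, hM0, hS⟩ := hS
  refine ⟨_, (hP _).2 ⟨M, hM, rfl⟩, (congr_eq_zero_iff P M).not.2 hM0, fun N hN => ?_⟩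
  obtain ⟨N', hN', rfl⟩ := (hP N).1 hN
  rw [← Matrix.add_mul, ← Matrix.mul_add]
  simp only [det_congr_eq_zero_iff]
  exact hS N' hN'

variable (K)

theorem mem_standardSpace {i : Fin 5} {M : Matrix (Fin 4) (Fin 4) K} :
    M ∈ standardSpace K i ↔ ∃ a b c : K, M =
      (![altOf a b c 0 0 0, altOf 0 0 0 a b c, altOf a b c c 0 0, altOf a b 0 0 c 0,
        altOf a b 0 0 c a] : Fin 5 → Matrix (Fin 4) (Fin 4) K) i := by
  rw [standardSpace, mem_span_triple]
  simp only [eq_comm (b := M)]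
  fin_cases i <;> simp [standardBasis, smul_altOf, altOf_add]

theorem allSingular_standardSpace (i : Fin 5) :
    AllSingular (standardSpace K i) ↔ i ≤ 1 := by
  simp only [AllSingular, mem_standardSpace]
  fin_cases i
  · refine iff_of_true ?_ (by decide)
    rintro _ ⟨a, b, c, rfl⟩
    simp [det_altOf]
  · refine iff_of_true ?_ (by decide)
    rintro _ ⟨a, b, c, rfl⟩
    simp [det_altOf]
  · refine iff_of_false (fun h => ?_) (by decide)
    have := h _ ⟨0, 0, 1, rfl⟩
    simp [det_altOf] at this
  · refine iff_of_false (fun h => ?_) (by decide)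
    have := h _ ⟨0, 1, 1, rfl⟩
    simp [det_altOf] at this
  · refine iff_of_false (fun h => ?_) (by decide)
    have := h _ ⟨1, 0, 0, rfl⟩
    simp [det_altOf] at this

theorem hasCommonKernel_standardSpace_one : HasCommonKernel (standardSpace K 1) := by
  refine ⟨Pi.single 0 1, by simp, fun M hM => ?_⟩
  obtain ⟨a, b, c, rfl⟩ := (mem_standardSpace K).1 hM
  ext r
  fin_cases r <;> simp [altOf]

theorem not_hasCommonKernel_standardSpace_zero : ¬ HasCommonKernel (standardSpace K 0) := by
  rintro ⟨x, hx, h⟩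
  apply hx
  have h1 := h _ ((mem_standardSpace K).2 ⟨1, 0, 0, rfl⟩)
  have h2 := h _ ((mem_standardSpace K).2 ⟨0, 1, 0, rfl⟩)
  have h3 := h _ ((mem_standardSpace K).2 ⟨0, 0, 1, rfl⟩)
  have e1 := congrFun h1 0
  have e2 := congrFun h2 0
  have e3 := congrFun h3 0
  have e4 := congrFun h1 1
  ext r
  fin_cases r <;> simp_all [altOf, Matrix.mulVec, dotProduct, Fin.sum_univ_four]

theorem singularAddClosed_standardSpace (i : Fin 5) :
    SingularAddClosed (standardSpace K i) ↔ i ≤ 2 := by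
  by_cases hi : i ≤ 1
  · have := (allSingular_standardSpace K i).2 hi
    exact ⟨fun _ => by omega, fun _ M hM N hN _ _ => this _ (add_mem hM hN)⟩
  simp only [SingularAddClosed, mem_standardSpace]
  fin_cases i
  · simp at hi
  · simp at hi
  · refine iff_of_true ?_ (by decide)
    rintro _ ⟨a, b, c, rfl⟩ _ ⟨a', b', c', rfl⟩
    simp +contextual [det_altOf, altOf_add]
  · refine iff_of_false (fun h => ?_) (by decide)
    have := h _ ⟨0, 1, 0, rfl⟩ _ ⟨0, 0, 1, rfl⟩
    simp [det_altOf, altOf_add] at this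
  · refine iff_of_false (fun h => ?_) (by decide)
    have := h _ ⟨0, 1, 0, rfl⟩ _ ⟨0, 0, 1, rfl⟩
    simp [det_altOf, altOf_add] at this

theorem hasSingularTranslation_standardSpace (i : Fin 5) :
    HasSingularTranslation (standardSpace K i) ↔ i ≤ 3 := by
  simp only [HasSingularTranslation, mem_standardSpace]
  fin_cases i
  · refine iff_of_true ⟨_, ⟨1, 0, 0, rfl⟩, by simp [altOf_eq_zero_iff], ?_⟩ (by decide)
    rintro _ ⟨a, b, c, rfl⟩
    simp [det_altOf, altOf_add]
  · refine iff_of_true ⟨_, ⟨1, 0, 0, rfl⟩, by simp [altOf_eq_zero_iff], ?_⟩ (by decide)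
    rintro _ ⟨a, b, c, rfl⟩
    simp [det_altOf, altOf_add]
  · refine iff_of_true ⟨_, ⟨1, 0, 0, rfl⟩, by simp [altOf_eq_zero_iff], ?_⟩ (by decide)
    rintro _ ⟨a, b, c, rfl⟩
    simp [det_altOf, altOf_add]
  · refine iff_of_true ⟨_, ⟨1, 0, 0, rfl⟩, by simp [altOf_eq_zero_iff], ?_⟩ (by decide)
    rintro _ ⟨a, b, c, rfl⟩
    simp [det_altOf, altOf_add]
  · refine iff_of_false ?_ (by decide)
    rintro ⟨_, ⟨a, b, c, rfl⟩, hM, h⟩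
    -- The form is a² − bc. Testing at 0 and at the two isotropic basis vectors and subtracting
    -- isolates c and b; then a² = 0. No division by 2 occurs.
    have h0 := h (altOf 0 0 0 0 0 0) ⟨0, 0, 0, rfl⟩ (by simp [det_altOf])
    have h1 := h (altOf 0 1 0 0 0 0) ⟨0, 1, 0, rfl⟩ (by simp [det_altOf])
    have h2 := h (altOf 0 0 0 0 1 0) ⟨0, 0, 1, rfl⟩ (by simp [det_altOf])
    change altOf a b 0 0 c a ≠ 0 at hM
    change (altOf a b 0 0 c a + _).det = 0 at h0 h1 h2
    simp only [det_altOf, altOf_add, sq_eq_zero_iff] at h0 h1 h2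
    have hc : c = 0 := by linear_combination h0 - h1
    have hb : b = 0 := by linear_combination h0 - h2
    have ha : a = 0 := by
      subst hb hc
      simpa using h0
    exact hM (altOf_eq_zero_iff.2 ⟨ha, hb, rfl, rfl, hc, ha⟩)

theorem eq_of_congruent_standardSpace {i j : Fin 5}
    (h : Congruent (standardSpace K i) (standardSpace K j)) : i = j := by
  have h1 : i ≤ 1 ↔ j ≤ 1 := by
    rw [← allSingular_standardSpace K, ← allSingular_standardSpace K]
    exact ⟨.congr h, .congr h.symm⟩
  have h2 : i ≤ 2 ↔ j ≤ 2 := by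
    rw [← singularAddClosed_standardSpace K, ← singularAddClosed_standardSpace K]
    exact ⟨.congr h, .congr h.symm⟩
  have h3 : i ≤ 3 ↔ j ≤ 3 := by
    rw [← hasSingularTranslation_standardSpace K, ← hasSingularTranslation_standardSpace K]
    exact ⟨.congr h, .congr h.symm⟩
  have h4 : ¬ (i = 0 ∧ j = 1) := by
    rintro ⟨rfl, rfl⟩
    exact not_hasCommonKernel_standardSpace_zero K
      (.congr h (hasCommonKernel_standardSpace_one K))
  have h5 : ¬ (i = 1 ∧ j = 0) := by
    rintro ⟨rfl, rfl⟩
    exact not_hasCommonKernel_standardSpace_zero K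
      (.congr h.symm (hasCommonKernel_standardSpace_one K))
  omega

end Invariants

/-! ### Reduction of an arbitrary 3-dimensional space to a standard one. -/

section Classification

variable {K : Type*} [Field K]

/-- The space is congruent to one of the five standard spaces. -/
def IsClassified (S : Submodule K (Matrix (Fin 4) (Fin 4) K)) : Prop :=
  ∃ i, Congruent (standardSpace K i) S

theorem IsClassified.congr {S T : Submodule K (Matrix (Fin 4) (Fin 4) K)}
    (hS : IsClassified S) (h : Congruent S T) : IsClassified T :=
  let ⟨i, hi⟩ := hS
  ⟨i, hi.trans h⟩

theorem isClassified_of_congr {A B C A' B' C' : Matrix (Fin 4) (Fin 4) K}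
    (P : Matrix (Fin 4) (Fin 4) K) (hP : P.det ≠ 0)
    (hA : P * A * Pᵀ = A') (hB : P * B * Pᵀ = B') (hC : P * C * Pᵀ = C')
    (hfr : Module.finrank K (span K {A, B, C}) = 3)
    (h : Module.finrank K (span K {A', B', C'}) = 3 → IsClassified (span K {A', B', C'})) :
    IsClassified (span K {A, B, C}) := by
  have hc := congruent_span_triple P hP hA hB hC
  exact (h (hc.finrank_eq ▸ hfr)).congr hc.symm

theorem det_fin_four_of_blocks (x x' y y' z z' t t' : K) :
    (!![x, x', 0, 0; y, y', 0, 0; 0, 0, z, z'; 0, 0, t, t'] :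
      Matrix (Fin 4) (Fin 4) K).det = (x * y' - x' * y) * (z * t' - z' * t) := by
  simp [Matrix.det_succ_row_zero, Fin.sum_univ_succ, Fin.succAbove]
  ring

theorem exists_unimodular_completion {x y : K} (h : x ≠ 0 ∨ y ≠ 0) :
    ∃ x' y', x * y' - x' * y = 1 := by
  rcases h with h | h
  · exact ⟨0, x⁻¹, by field_simp; ring⟩
  · exact ⟨-y⁻¹, 0, by field_simp; ring⟩

/-- A nonzero singular 2 × 2 matrix is an outer product of two nonzero vectors, each of which
extends to a basis of determinant 1. -/
theorem exists_rank_one_factorization {α β γ δ : K} (hD : α * δ - β * γ = 0)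
    (h : ¬ (α = 0 ∧ β = 0 ∧ γ = 0 ∧ δ = 0)) :
    ∃ x y z t x' y' z' t' : K, α = x * z ∧ β = x * t ∧ γ = y * z ∧ δ = y * t ∧
      x * y' - x' * y = 1 ∧ z * t' - z' * t = 1 := by
  have key : ∃ x y z t : K, α = x * z ∧ β = x * t ∧ γ = y * z ∧ δ = y * t := by
    by_cases hα : α = 0
    · by_cases hβ : β = 0
      · exact ⟨0, 1, γ, δ, by simp [hα], by simp [hβ], by simp, by simp⟩
      · refine ⟨β, δ, 0, 1, by simp [hα], by simp, ?_, by simp⟩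
        have : β * γ = 0 := by linear_combination δ * hα - hD
        simpa [hβ] using this
    · refine ⟨1, γ / α, α, β, by simp, by simp, by field_simp, ?_⟩
      field_simp
      linear_combination hD
  obtain ⟨x, y, z, t, rfl, rfl, rfl, rfl⟩ := key
  have h1 : x ≠ 0 ∨ y ≠ 0 := by
    by_contra! h0
    simp [h0.1, h0.2] at h
  have h2 : z ≠ 0 ∨ t ≠ 0 := by
    by_contra! h0
    simp [h0.1, h0.2] at h
  obtain ⟨x', y', hx⟩ := exists_unimodular_completion h1
  obtain ⟨z', t', hz⟩ := exists_unimodular_completion h2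
  exact ⟨x, y, z, t, x', y', z', t', rfl, rfl, rfl, rfl, hx, hz⟩

/-- The first generator is orthogonal to the hyperbolic pair e₀ ∧ e₁, e₂ ∧ e₃, so only its
off-diagonal 2 × 2 block matters: rank one gives 𝐀₄, rank two gives 𝐀₅. -/
theorem isClassified_of_hyperbolic {α β γ δ : K} (h : ¬ (α = 0 ∧ β = 0 ∧ γ = 0 ∧ δ = 0)) :
    IsClassified
      (span K {altOf 0 α β γ δ 0, altOf 1 0 0 0 0 0, altOf 0 0 0 0 0 (1 : K)}) := by
  by_cases hD : α * δ - β * γ = 0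
  · obtain ⟨x, y, z, t, x', y', z', t', rfl, rfl, rfl, rfl, hx, hz⟩ :=
      exists_rank_one_factorization hD h
    -- The block is u ∧ v with u = (x, y) in ⟨e₀, e₁⟩ and v = (z, t) in ⟨e₂, e₃⟩. The columns are u,
    -- v, u', v', so that u ∧ u' = e₀ ∧ e₁ and v ∧ v' = e₂ ∧ e₃.
    refine ⟨3, congruent_span_triple
      !![x, 0, x', 0; y, 0, y', 0; 0, z, 0, z'; 0, t, 0, t'] ?_ ?_ ?_ ?_⟩
    · have : (!![x, 0, x', 0; y, 0, y', 0; 0, z, 0, z'; 0, t, 0, t'] :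
          Matrix (Fin 4) (Fin 4) K).det = -((x * y' - x' * y) * (z * t' - z' * t)) := by
        simp [Matrix.det_succ_row_zero, Fin.sum_univ_succ, Fin.succAbove]
        ring
      rw [this, hx, hz]
      simp
    · refine (congr_altOf _ 1 0 0 0 0 0).trans (altOf_inj.2 ?_)
      simp
    · refine (congr_altOf _ 0 1 0 0 0 0).trans (altOf_inj.2 ?_)
      simpa using hx
    · refine (congr_altOf _ 0 0 0 0 1 0).trans (altOf_inj.2 ?_)
      simpa using hz
  · rw [span_triple_change_right (C' := altOf 0 0 0 0 0 (α * δ - β * γ)) 0 0 hD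
      (by simp [smul_altOf])]
    -- The columns are e₀, αe₂ + βe₃, e₁, γe₂ + δe₃; the wedge of the second and fourth is (αδ − βγ)
    -- e₂ ∧ e₃, hence the rescaling above.
    refine ⟨4, congruent_span_triple
      !![1, 0, 0, 0; 0, 0, 1, 0; 0, α, 0, γ; 0, β, 0, δ] ?_ ?_ ?_ ?_⟩
    · have : (!![1, 0, 0, 0; 0, 0, 1, 0; 0, α, 0, γ; 0, β, 0, δ] :
          Matrix (Fin 4) (Fin 4) K).det = -(α * δ - β * γ) := by
        simp [Matrix.det_succ_row_zero, Fin.sum_univ_succ, Fin.succAbove]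
        ring
      rwa [this, neg_ne_zero]
    · refine (congr_altOf _ 1 0 0 0 0 1).trans (altOf_inj.2 ?_)
      simp
    · refine (congr_altOf _ 0 1 0 0 0 0).trans (altOf_inj.2 ?_)
      simp
    · refine (congr_altOf _ 0 0 0 0 1 0).trans (altOf_inj.2 ?_)
      simp
      ring

/-- The coordinate f' is the polar pairing with e₀ ∧ e₁. When it is nonzero, the two generators span
a hyperbolic plane, which can be moved to ⟨e₀ ∧ e₁, e₂ ∧ e₃⟩. -/
theorem isClassified_of_pairing_ne_zero {a b c d e f a' b' c' d' e' f' : K} (hf : f' ≠ 0)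
    (hfr : Module.finrank K (span K
      {altOf a b c d e f, altOf 1 0 0 0 0 0, altOf a' b' c' d' e' f'}) = 3) :
    IsClassified (span K
      {altOf a b c d e f, altOf 1 0 0 0 0 0, altOf a' b' c' d' e' f'}) := by
  obtain ⟨b₁, c₁, d₁, e₁, hC⟩ : ∃ b₁ c₁ d₁ e₁ : K,
      span K {altOf a b c d e f, altOf 1 0 0 0 0 0, altOf a' b' c' d' e' f'} =
        span K {altOf a b c d e f, altOf 1 0 0 0 0 0,
          altOf (b₁ * e₁ - c₁ * d₁) b₁ c₁ d₁ e₁ 1} := by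
    -- Scale the last coordinate to 1, then add the multiple of e₀ ∧ e₁ that makes the Pfaffian
    -- vanish.
    refine ⟨f'⁻¹ * b', f'⁻¹ * c', f'⁻¹ * d', f'⁻¹ * e', span_triple_change_right 0
      (f'⁻¹ * b' * (f'⁻¹ * e') - f'⁻¹ * c' * (f'⁻¹ * d') - f'⁻¹ * a') (inv_ne_zero hf) ?_⟩
    simp [smul_altOf, altOf_add, hf]
  rw [hC] at hfr ⊢
  -- This unipotent matrix fixes e₀ ∧ e₁ and clears the remaining coordinates of the isotropic
  -- partner.
  have hdet : (!![1, 0, -c₁, b₁; 0, 1, -e₁, d₁; 0, 0, 1, 0; 0, 0, 0, 1] :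
      Matrix (Fin 4) (Fin 4) K).det ≠ 0 := by
    simp [Matrix.det_succ_row_zero, Fin.sum_univ_succ, Fin.succAbove]
  refine isClassified_of_congr _ hdet (congr_altOf _ _ _ _ _ _ _)
    (B' := altOf 1 0 0 0 0 0) (C' := altOf 0 0 0 0 0 1) ?_ ?_ hfr ?_
  · refine (congr_altOf _ _ _ _ _ _ _).trans (altOf_inj.2 ?_)
    simp
  · refine (congr_altOf _ _ _ _ _ _ _).trans (altOf_inj.2 ?_)
    simp
    ring
  suffices H : ∀ a b c d e f : K, Module.finrank K (span K
      {altOf a b c d e f, altOf 1 0 0 0 0 0, altOf 0 0 0 0 0 1}) = 3 → IsClassified (span K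
      {altOf a b c d e f, altOf 1 0 0 0 0 0, altOf 0 0 0 0 0 1}) from H _ _ _ _ _ _
  intro a b c d e f hfr
  rw [span_triple_change_left (A' := altOf 0 b c d e 0) one_ne_zero (-a) (-f)
    (by simp only [smul_altOf, altOf_add, altOf_inj]; simp)] at hfr ⊢
  refine isClassified_of_hyperbolic fun h => ne_zero_of_finrank_span_triple hfr ?_
  simpa [altOf_eq_zero_iff] using h

/-- Up to sign, f and e are the pairings of the third generator with the other two. If either is
nonzero, the hyperbolic case applies, after exchanging e₁ and e₂ when it is e. Otherwise c e₀ ∧ e₃ +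
d e₁ ∧ e₂ remains, of Pfaffian cd: 𝐀₂ if c = 0, 𝐀₁ if d = 0, 𝐀₃ otherwise. -/
theorem isClassified_of_isotropic_pair {a b c d e f : K}
    (hfr : Module.finrank K (span K
      {altOf a b c d e f, altOf 1 0 0 0 0 0, altOf 0 1 0 0 0 0}) = 3) :
    IsClassified (span K
      {altOf a b c d e f, altOf 1 0 0 0 0 0, altOf 0 1 0 0 0 0}) := by
  by_cases hf : f = 0
  swap
  · have hS : span K {altOf a b c d e f, altOf 1 0 0 0 0 0, altOf 0 1 0 0 0 0} =
        span K {altOf 0 1 0 0 0 0, altOf 1 0 0 0 0 0, altOf a b c d e f} := by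
      rw [span_triple_swap_right, span_triple_swap_left, span_triple_swap_right]
    rw [hS] at hfr ⊢
    exact isClassified_of_pairing_ne_zero hf hfr
  by_cases he : e = 0
  swap
  · have hS : span K {altOf a b c d e f, altOf 1 0 0 0 0 0, altOf 0 1 0 0 0 0} =
        span K {altOf 1 0 0 0 0 0, altOf 0 1 0 0 0 0, altOf a b c d e f} := by
      rw [span_triple_swap_left, span_triple_swap_right]
    rw [hS] at hfr ⊢
    have hdet : (!![1, 0, 0, 0; 0, 0, 1, 0; 0, 1, 0, 0; 0, 0, 0, 1] :
        Matrix (Fin 4) (Fin 4) K).det ≠ 0 := by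
      simp [Matrix.det_succ_row_zero, Fin.sum_univ_succ, Fin.succAbove]
    refine isClassified_of_congr _ hdet (A' := altOf 0 1 0 0 0 0)
      (B' := altOf 1 0 0 0 0 0) (C' := altOf b a c (-d) f e) ?_ ?_ ?_ hfr
      (isClassified_of_pairing_ne_zero he) <;>
    · refine (congr_altOf _ _ _ _ _ _ _).trans (altOf_inj.2 ?_)
      simp
  subst he hf
  rw [span_triple_change_left (A' := altOf 0 0 c d 0 0) one_ne_zero (-a) (-b)
    (by simp only [smul_altOf, altOf_add, altOf_inj]; simp), span_triple_swap_left, span_triple_swap_right] at hfr ⊢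
  by_cases hc : c = 0
  · subst hc
    have hd : d ≠ 0 := by
      rintro rfl
      rw [span_triple_swap_right, span_triple_swap_left] at hfr
      exact ne_zero_of_finrank_span_triple hfr altOf_eq_zero
    rw [span_triple_change_right (C' := altOf 0 0 0 1 0 0) 0 0 (inv_ne_zero hd)
      (by simp [smul_altOf, hd])]
    refine ⟨1, congruent_span_triple !![0, 1, 0, 0; 0, 0, 1, 0; 0, 0, 0, 1; 1, 0, 0, 0]
      (by simp [Matrix.det_succ_row_zero, Fin.sum_univ_succ, Fin.succAbove]) ?_ ?_ ?_⟩
    · exact (congr_altOf _ 0 0 0 1 0 0).trans (altOf_inj.2 (by simp))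
    · exact (congr_altOf _ 0 0 0 0 1 0).trans (altOf_inj.2 (by simp))
    · exact (congr_altOf _ 0 0 0 0 0 1).trans (altOf_inj.2 (by simp))
  · by_cases hd : d = 0
    · subst hd
      refine ⟨0, congruent_span_triple !![1, 0, 0, 0; 0, 1, 0, 0; 0, 0, 1, 0; 0, 0, 0, c]
        (by simp [Matrix.det_succ_row_zero, Fin.sum_univ_succ, Fin.succAbove, hc]) ?_ ?_ ?_⟩
      · exact (congr_altOf _ 1 0 0 0 0 0).trans (altOf_inj.2 (by simp))
      · exact (congr_altOf _ 0 1 0 0 0 0).trans (altOf_inj.2 (by simp))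
      · exact (congr_altOf _ 0 0 1 0 0 0).trans (altOf_inj.2 (by simp))
    · rw [span_triple_change_left (A' := altOf (c * d) 0 0 0 0 0) (mul_ne_zero hc hd) 0 0
        (by simp [smul_altOf]), span_triple_change_mid (B' := altOf 0 c 0 0 0 0) 0 hc 0
        (by simp [smul_altOf])]
      refine ⟨2, congruent_span_triple !![c, 0, 0, 0; 0, d, 0, 0; 0, 0, 1, 0; 0, 0, 0, 1]
        (by simp [Matrix.det_succ_row_zero, Fin.sum_univ_succ, Fin.succAbove, hc, hd])
        ?_ ?_ ?_⟩
      · exact (congr_altOf _ 1 0 0 0 0 0).trans (altOf_inj.2 (by simp))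
      · exact (congr_altOf _ 0 1 0 0 0 0).trans (altOf_inj.2 (by simp))
      · exact (congr_altOf _ 0 0 1 1 0 0).trans (altOf_inj.2 (by simp))

/-- Dehomogenize at y = 1, unless the leading coefficient vanishes. The classification uses
quadratic closedness only through this lemma. -/
theorem exists_isotropic_combination (hK : QuadraticallyClosed K)
    (q : K → K → K) (A B C : K) (hq : ∀ x y, q x y = A * x ^ 2 + B * x * y + C * y ^ 2) :
    ∃ x y, (x ≠ 0 ∨ y ≠ 0) ∧ q x y = 0 := by
  by_cases hA : A = 0
  · exact ⟨1, 0, by simp, by simp [hq, hA]⟩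
  · obtain ⟨x, hx⟩ := hK (B / A) (C / A)
    refine ⟨x, 1, by simp, ?_⟩
    rw [hq]
    field_simp at hx
    linear_combination hx

theorem isClassified_of_mem_fst (hK : QuadraticallyClosed K)
    {a b c d e f a' b' c' d' e' f' : K}
    (hfr : Module.finrank K (span K
      {altOf a b c d e f, altOf 1 0 0 0 0 0, altOf a' b' c' d' e' f'}) = 3) :
    IsClassified (span K
      {altOf a b c d e f, altOf 1 0 0 0 0 0, altOf a' b' c' d' e' f'}) := by
  by_cases hf' : f' = 0
  swap
  · exact isClassified_of_pairing_ne_zero hf' hfr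
  have hswap : ∀ A B C : Matrix (Fin 4) (Fin 4) K, span K {A, B, C} = span K {C, B, A} := by
    intro A B C
    rw [span_triple_swap_right, span_triple_swap_left, span_triple_swap_right]
  by_cases hf : f = 0
  swap
  · rw [hswap] at hfr ⊢
    exact isClassified_of_pairing_ne_zero hf hfr
  subst hf hf'
  -- With f = f' = 0 both generators are orthogonal to e₀ ∧ e₁, so modulo it the Pfaffian is, up to
  -- sign, the determinant of the 2 × 2 block.
  obtain ⟨x, y, hxy, hD⟩ := exists_isotropic_combination hK
    (fun x y => (x * b + y * b') * (x * e + y * e') - (x * c + y * c') * (x * d + y * d'))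
    (b * e - c * d) (b * e' + b' * e - c * d' - c' * d) (b' * e' - c' * d')
    (by intro x y; ring)
  obtain ⟨a₁, b₁, c₁, d₁, e₁, hS⟩ : ∃ a₁ b₁ c₁ d₁ e₁ : K,
      span K {altOf a b c d e 0, altOf 1 0 0 0 0 0, altOf a' b' c' d' e' 0} =
        span K {altOf 0 (x * b + y * b') (x * c + y * c') (x * d + y * d') (x * e + y * e') 0,
          altOf 1 0 0 0 0 0, altOf a₁ b₁ c₁ d₁ e₁ 0} := by
    by_cases hx : x = 0
    · have hy : y ≠ 0 := by simpa [hx] using hxy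
      refine ⟨a, b, c, d, e, ?_⟩
      rw [hswap]
      refine span_triple_change_left hy (-(x * a + y * a')) x ?_
      simp only [smul_altOf, altOf_add, altOf_inj]
      simp [hx]
    · refine ⟨a', b', c', d', e', ?_⟩
      refine span_triple_change_left hx (-(x * a + y * a')) y ?_
      simp only [smul_altOf, altOf_add, altOf_inj]
      simp
  rw [hS] at hfr ⊢
  generalize x * b + y * b' = α, x * c + y * c' = β, x * d + y * d' = γ,
    x * e + y * e' = δ at *
  have hne := ne_zero_of_finrank_span_triple hfr
  obtain ⟨x, y, z, t, x', y', z', t', rfl, rfl, rfl, rfl, hx, hz⟩ :=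
    exists_rank_one_factorization hD (fun h => hne (by simpa [altOf_eq_zero_iff] using h))
  rw [hswap] at hfr ⊢
  -- The inverse of the block matrix with columns u, u', v, v': it sends u ∧ v to e₀ ∧ e₂ and fixes
  -- e₀ ∧ e₁.
  refine isClassified_of_congr !![y', -x', 0, 0; -y, x, 0, 0; 0, 0, t', -z'; 0, 0, -t, z]
    ?_ (congr_altOf _ _ _ _ _ _ _) (B' := altOf 1 0 0 0 0 0) (C' := altOf 0 1 0 0 0 0)
    ?_ ?_ hfr isClassified_of_isotropic_pair
  · rw [det_fin_four_of_blocks]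
    have : (y' * x - -x' * -y) * (t' * z - -z' * -t) = 1 := by
      linear_combination (z * t' - z' * t) * hx + hz
    rw [this]
    exact one_ne_zero
  · refine (congr_altOf _ _ _ _ _ _ _).trans (altOf_inj.2 ?_)
    simp
    linear_combination hx
  · refine (congr_altOf _ _ _ _ _ _ _).trans (altOf_inj.2 ?_)
    simp
    refine ⟨?_, ?_, ?_, ?_⟩
    · linear_combination (z * t' - z' * t) * hx + hz
    all_goals ring

/-- All decomposable bivectors are equivalent. A permutation brings a nonzero entry to position (0,
1), and pivoting on it clears the rest. -/
theorem exists_congr_eq_of_isotropic {a b c d e f : K} (hD : a * f - b * e + c * d = 0)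
    (h : altOf a b c d e f ≠ 0) :
    ∃ P : Matrix (Fin 4) (Fin 4) K, P.det ≠ 0 ∧
      P * altOf a b c d e f * Pᵀ = altOf 1 0 0 0 0 0 := by
  have main : ∀ {a b c d e f : K}, a * f - b * e + c * d = 0 → a ≠ 0 →
      ∃ P : Matrix (Fin 4) (Fin 4) K, P.det ≠ 0 ∧
        P * altOf a b c d e f * Pᵀ = altOf 1 0 0 0 0 0 := by
    intro a b c d e f hD ha
    -- Elimination leaves Pfaffian / a in position (2, 3), which vanishes by `hD`.
    refine ⟨!![a⁻¹, 0, 0, 0; 0, 1, 0, 0; d / a, -b / a, 1, 0; e / a, -c / a, 0, 1], ?_, ?_⟩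
    · simp [Matrix.det_succ_row_zero, Fin.sum_univ_succ, Fin.succAbove, ha]
    · refine (congr_altOf _ _ _ _ _ _ _).trans (altOf_inj.2 ?_)
      simp
      refine ⟨mul_inv_cancel₀ ha, ?_, ?_, ?_, ?_, ?_⟩ <;> field_simp
      on_goal 5 => linear_combination hD
      all_goals ring
  -- The sign alternative reflects the parity of the permutation, since the Pfaffian is multiplied
  -- by det Q.
  have perm : ∀ (Q : Matrix (Fin 4) (Fin 4) K), Q.det ≠ 0 → ∀ a' b' c' d' e' f' : K,
      Q * altOf a b c d e f * Qᵀ = altOf a' b' c' d' e' f' →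
      a' * f' - b' * e' + c' * d' = a * f - b * e + c * d ∨
        a' * f' - b' * e' + c' * d' = -(a * f - b * e + c * d) → a' ≠ 0 →
      ∃ P : Matrix (Fin 4) (Fin 4) K, P.det ≠ 0 ∧
        P * altOf a b c d e f * Pᵀ = altOf 1 0 0 0 0 0 := by
    intro Q hQ a' b' c' d' e' f' hQ' hD' ha'
    rw [hD, neg_zero, or_self] at hD'
    obtain ⟨P, hP, hP'⟩ := main hD' ha'
    refine ⟨P * Q, by simp [hP, hQ], ?_⟩
    rw [← hP', ← hQ']
    simp only [transpose_mul, Matrix.mul_assoc]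
  by_cases ha : a = 0
  swap
  · exact main hD ha
  by_cases hb : b = 0
  swap
  · exact perm !![1, 0, 0, 0; 0, 0, 1, 0; 0, 1, 0, 0; 0, 0, 0, 1]
      (by simp [Matrix.det_succ_row_zero, Fin.sum_univ_succ, Fin.succAbove]) b a c (-d) f e
      ((congr_altOf _ _ _ _ _ _ _).trans (altOf_inj.2 (by simp))) (.inr (by ring)) hb
  by_cases hc : c = 0
  swap
  · exact perm !![1, 0, 0, 0; 0, 0, 0, 1; 0, 0, 1, 0; 0, 1, 0, 0]
      (by simp [Matrix.det_succ_row_zero, Fin.sum_univ_succ, Fin.succAbove]) c b a (-f) (-e) (-d)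
      ((congr_altOf _ _ _ _ _ _ _).trans (altOf_inj.2 (by simp))) (.inr (by ring)) hc
  by_cases hd : d = 0
  swap
  · exact perm !![0, 1, 0, 0; 0, 0, 1, 0; 1, 0, 0, 0; 0, 0, 0, 1]
      (by simp [Matrix.det_succ_row_zero, Fin.sum_univ_succ, Fin.succAbove]) d (-a) e (-b) f c
      ((congr_altOf _ _ _ _ _ _ _).trans (altOf_inj.2 (by simp))) (.inl (by ring)) hd
  by_cases he : e = 0
  swap
  · exact perm !![0, 1, 0, 0; 0, 0, 0, 1; 1, 0, 0, 0; 0, 0, 1, 0]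
      (by simp [Matrix.det_succ_row_zero, Fin.sum_univ_succ, Fin.succAbove]) e (-a) d (-c) (-f) b
      ((congr_altOf _ _ _ _ _ _ _).trans (altOf_inj.2 (by simp))) (.inr (by ring)) he
  have hf : f ≠ 0 := by
    rintro rfl
    exact h (altOf_eq_zero_iff.2 ⟨ha, hb, hc, hd, he, rfl⟩)
  exact perm !![0, 0, 1, 0; 0, 0, 0, 1; 1, 0, 0, 0; 0, 1, 0, 0]
    (by simp [Matrix.det_succ_row_zero, Fin.sum_univ_succ, Fin.succAbove]) f (-b) (-d) (-c) (-e) a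
    ((congr_altOf _ _ _ _ _ _ _).trans (altOf_inj.2 (by simp))) (.inl (by ring)) hf

theorem isClassified_span_of_isotropic (hK : QuadraticallyClosed K)
    {a b c d e f : K} (hD : a * f - b * e + c * d = 0) {B C : Matrix (Fin 4) (Fin 4) K}
    (hB : B ∈ altMatrices K 4) (hC : C ∈ altMatrices K 4)
    (hfr : Module.finrank K (span K {altOf a b c d e f, B, C}) = 3) :
    IsClassified (span K {altOf a b c d e f, B, C}) := by
  obtain ⟨P, hP, hP'⟩ := exists_congr_eq_of_isotropic hD (ne_zero_of_finrank_span_triple hfr)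
  obtain ⟨b₁, b₂, b₃, b₄, b₅, b₆, rfl⟩ := exists_eq_altOf hB
  obtain ⟨c₁, c₂, c₃, c₄, c₅, c₆, rfl⟩ := exists_eq_altOf hC
  rw [span_triple_swap_left] at hfr ⊢
  exact isClassified_of_congr P hP (congr_altOf _ _ _ _ _ _ _) hP'
    (congr_altOf _ _ _ _ _ _ _) hfr (isClassified_of_mem_fst hK)

theorem isClassified_span (hK : QuadraticallyClosed K) {A B C : Matrix (Fin 4) (Fin 4) K}
    (hA : A ∈ altMatrices K 4) (hB : B ∈ altMatrices K 4) (hC : C ∈ altMatrices K 4)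
    (hfr : Module.finrank K (span K {A, B, C}) = 3) : IsClassified (span K {A, B, C}) := by
  obtain ⟨a, b, c, d, e, f, hA'⟩ := exists_eq_altOf hA
  obtain ⟨a', b', c', d', e', f', hB'⟩ := exists_eq_altOf hB
  obtain ⟨x, y, hxy, hD⟩ := exists_isotropic_combination hK
    (fun x y => (x * a + y * a') * (x * f + y * f') - (x * b + y * b') * (x * e + y * e') +
      (x * c + y * c') * (x * d + y * d'))
    (a * f - b * e + c * d) (a * f' + a' * f - b * e' - b' * e + c * d' + c' * d)
    (a' * f' - b' * e' + c' * d')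
    (by intro x y; ring)
  have hcomb : altOf (x * a + y * a') (x * b + y * b') (x * c + y * c') (x * d + y * d')
      (x * e + y * e') (x * f + y * f') = x • A + y • B := by
    rw [hA', hB', smul_altOf, smul_altOf, altOf_add]
  by_cases hx : x = 0
  · have hy : y ≠ 0 := by simpa [hx] using hxy
    rw [span_triple_swap_left, span_triple_change_left hy x 0
      (hcomb.trans (by rw [zero_smul, add_zero, add_comm]))] at hfr ⊢
    exact isClassified_span_of_isotropic hK hD hA hC hfr
  · rw [span_triple_change_left hx y 0
      (hcomb.trans (by rw [zero_smul, add_zero]))] at hfr ⊢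
    exact isClassified_span_of_isotropic hK hD hB hC hfr

theorem isClassified_of_finrank_eq_three (hK : QuadraticallyClosed K)
    {S : Submodule K (Matrix (Fin 4) (Fin 4) K)} (hS : S ≤ altMatrices K 4)
    (hfr : Module.finrank K S = 3) : IsClassified S := by
  let v := Module.finBasisOfFinrankEq K S hfr
  have hv : S = span K {(v 0 : Matrix (Fin 4) (Fin 4) K), ↑(v 1), ↑(v 2)} := by
    ext M
    rw [mem_span_triple]
    constructor
    · intro hM
      have := congrArg Subtype.val (v.sum_repr ⟨M, hM⟩)
      rw [Fin.sum_univ_three] at this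
      exact ⟨_, _, _, this⟩
    · rintro ⟨x, y, z, rfl⟩
      exact (x • v 0 + y • v 1 + z • v 2).2
  rw [hv] at hfr ⊢
  exact isClassified_span hK (hS (v 0).2) (hS (v 1).2) (hS (v 2).2) hfr

end Classification

end AltSpaces

/-- Over a quadratically closed field, the five spaces with generic matrices `𝐀₁, …, 𝐀₅` are
3-dimensional subspaces of the alternating `4 × 4` matrices, and sending each of them to its
congruence class is a bijection onto the set of all congruence classes of such subspaces. -/
theorem mainTheorem9 (K : Type*) [Field K] (hK : AltSpaces.QuadraticallyClosed K) :
    ∃ V : Fin 5 → AltSpaces.AltSubspace K 4 3,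
      (∀ i, AltSpaces.IsGenericMatrix (V i).1 (AltSpaces.genericMatrix K i)) ∧
      Function.Bijective fun i : Fin 5 =>
        (Quotient.mk (AltSpaces.congruenceSetoid K 4 3) (V i) :
          Quotient (AltSpaces.congruenceSetoid K 4 3)) := by
  refine ⟨fun i => ⟨AltSpaces.standardSpace K i, AltSpaces.standardSpace_le K i,
    AltSpaces.finrank_standardSpace K i⟩, AltSpaces.isGenericMatrix_standardSpace K, ?_, ?_⟩
  · intro i j hij
    exact AltSpaces.eq_of_congruent_standardSpace K (Quotient.exact hij)
  · intro c
    induction c using Quotient.inductionOn with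
    | h S =>
      obtain ⟨i, hi⟩ := AltSpaces.isClassified_of_finrank_eq_three hK S.2.1 S.2.2
      exact ⟨i, Quotient.sound hi⟩
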